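/- **Model.** For each sample size $n\ge 1$ and $1\le i\le n$, $$Y_{i}=\beta_0+\beta_1D_{i}+\epsilon_i,\qquad D_{i}=\pi_0+\pi_1Z_i+\eta_i,\qquad \pi_1=\pi_{1,n}=\frac{c}{\sqrt n},$$ with fixed real $\beta_0,\beta_1,\pi_0,c$. The error pairs $(\epsilon_i,\eta_i)$ are i.i.d. with finite variances ($\epsilon_i$ and $\eta_i$ may be correlated), and the instruments satisfy one of the following two sampling assumptions: 1. (fixed instruments) the $Z_i$ are constants with $\frac1n\sum_{i=1}^n (Z_i-\bar Z_n)^2\to 1$; or 2. (stochastic instruments) the triples $(Z_i,\epsilon_i,\eta_i)$ are i.i.d., $Z_i$ is independent of $(\epsilon_i,\eta_i)$, $\mathrm{Var}(Z_i)=1$ and $E[Z_i^4]<\infty$. Let $(\lambda_n)$ be a real sequence with $\lambda_n/n\to\lambda_0$ for some $\lambda_0>0$, let $\sigma_{\rm red}^2=\mathrm{Var}(\beta_1\eta_i+\epsilon_i)$, and let $$\hat\beta_{\rm ridge}=\frac{\sum_{i=1}^n(Y_i-\bar Y)(Z_i-\bar Z)}{\sum_{i=1}^n(D_i-\bar D)(Z_i-\bar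 Z)+\lambda_n},\qquad \hat\beta_{\rm 2SLS}=\frac{\sum_{i=1}^n(Y_i-\bar Y)(Z_i-\bar Z)}{\sum_{i=1}^n(D_i-\bar D)(Z_i-\bar Z)}.$$ **Theorem.** As $n\to\infty$, $$\sqrt n\,\hat\beta_{\rm ridge}\ \xrightarrow{d}\ \mathcal N\!\left(\frac{c\beta_1}{\lambda_0},\ \frac{\sigma_{\rm red}^2}{\lambda_0^2}\right)$$ (a normal law of variance $0$ being a point mass). By contrast, if $\mathrm{Var}(\eta_i)>0$, then for every real $b$ with $\mathrm{Var}\big((\beta_1-b)\eta_i+\epsilon_i\big)>0$ one has $P\big(|\sqrt n(\hat\beta_{\rm 2SLS}-b)|\le M\big)\to0$ for every $M$, and $\sqrt n(\hat\beta_{\rm 2SLS}-b)$ does not converge in distribution to any probability law on $\mathbb R$. In particular this holds for $\sqrt n\,\hat\beta_{\rm 2SLS}$ if $\sigma_{\rm red}^2>0$, and for $\sqrt n(\hat\beta_{\rm 2SLS}-\beta_1)$ if $\mathrm{Var}(\epsilon_i)>0$. -/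

import Mathlib

open MeasureTheory ProbabilityTheory Filter Topology

namespace RidgeIV

/-- Sample mean of the first `n` observations. -/
noncomputable def sampleMean (n : ℕ) (x : ℕ → ℝ) : ℝ :=
  (∑ i ∈ Finset.range n, x i) / n

/-- Centred cross-product `∑ i < n, (x i - x̄) * (z i - z̄)`. -/
noncomputable def crossSum (n : ℕ) (x z : ℕ → ℝ) : ℝ :=
  ∑ i ∈ Finset.range n, (x i - sampleMean n x) * (z i - sampleMean n z)

/-- Sample covariance, with the normalisation `1 / n`. -/
noncomputable def sampleCov (n : ℕ) (x z : ℕ → ℝ) : ℝ :=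
  crossSum n x z / n

/-- Just-identified ridge IV estimator with penalty `lam`, from the first `n` observations of
outcome `y`, endogenous regressor `d`, instrument `z`. -/
noncomputable def ridgeIV (n : ℕ) (y d z : ℕ → ℝ) (lam : ℝ) : ℝ :=
  crossSum n y z / (crossSum n d z + lam)

/-- Just-identified two-stage least squares estimator. -/
noncomputable def twoSLS (n : ℕ) (y d z : ℕ → ℝ) : ℝ :=
  crossSum n y z / crossSum n d z

/-- First stage `D_i = π₀ + π₁ Z_i + η_i`. -/
def firstStage (π₀ π₁ : ℝ) (z η : ℕ → ℝ) (i : ℕ) : ℝ :=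
  π₀ + π₁ * z i + η i

/-- Structural equation `Y_i = β₀ + β₁ D_i + ε_i`. -/
def outcome (β₀ β₁ : ℝ) (d ε : ℕ → ℝ) (i : ℕ) : ℝ :=
  β₀ + β₁ * d i + ε i

/-- Local-to-zero (weak) first-stage coefficient at sample size `n`. -/
noncomputable def weakCoef (c : ℝ) (n : ℕ) : ℝ :=
  c / √(n : ℝ)

/-- Row `n` of the endogenous regressor when `π₁ = c / √n`. -/
noncomputable def weakD (π₀ c : ℝ) (z η : ℕ → ℝ) (n : ℕ) : ℕ → ℝ :=
  firstStage π₀ (weakCoef c n) z η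

/-- Row `n` of the outcome when `π₁ = c / √n`. -/
noncomputable def weakY (β₀ β₁ π₀ c : ℝ) (z ε η : ℕ → ℝ) (n : ℕ) : ℕ → ℝ :=
  outcome β₀ β₁ (weakD π₀ c z η n) ε

variable {Ω : Type*} [MeasurableSpace Ω]

/-- The pairs `(ε_i, η_i)` are iid with finite variances; `ε_i` and `η_i` may be dependent. -/
structure IIDErrors (P : Measure Ω) (ε η : ℕ → Ω → ℝ) : Prop where
  measurable_eps : ∀ i, Measurable (ε i)
  measurable_eta : ∀ i, Measurable (η i)
  indep : iIndepFun (fun i ω => (ε i ω, η i ω)) P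
  ident : ∀ i, IdentDistrib (fun ω => (ε i ω, η i ω)) (fun ω => (ε 0 ω, η 0 ω)) P P
  memLp_eps : MemLp (ε 0) 2 P
  memLp_eta : MemLp (η 0) 2 P

/-- Instruments treated as constants, with limiting sample second moment about the mean equal
to one. -/
def FixedInstruments (Z : ℕ → Ω → ℝ) : Prop :=
  ∃ z : ℕ → ℝ, (∀ i ω, Z i ω = z i) ∧ Tendsto (fun n => sampleCov n z z) atTop (𝓝 1)

/-- Stochastic instruments: the data `(Z_i, ε_i, η_i)` are iid, `Z_i` is independent of
`(ε_i, η_i)`, has unit variance and a finite fourth moment. -/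
structure StochasticInstruments (P : Measure Ω) (Z ε η : ℕ → Ω → ℝ) : Prop where
  measurable : ∀ i, Measurable (Z i)
  indep : iIndepFun (fun i ω => (Z i ω, ε i ω, η i ω)) P
  ident : ∀ i,
    IdentDistrib (fun ω => (Z i ω, ε i ω, η i ω)) (fun ω => (Z 0 ω, ε 0 ω, η 0 ω)) P P
  exogenous : ∀ i, IndepFun (Z i) (fun ω => (ε i ω, η i ω)) P
  memLp : MemLp (Z 0) 4 P
  variance_eq : variance (Z 0) P = 1

/-- `√n` times (ridge IV estimator) under weak instruments, as a random variable. -/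
noncomputable def scaledRidge (β₀ β₁ π₀ c : ℝ) (lam : ℕ → ℝ) (Z ε η : ℕ → Ω → ℝ)
    (n : ℕ) (ω : Ω) : ℝ :=
  √(n : ℝ) * ridgeIV n (weakY β₀ β₁ π₀ c (fun i => Z i ω) (fun i => ε i ω) (fun i => η i ω) n)
    (weakD π₀ c (fun i => Z i ω) (fun i => η i ω) n) (fun i => Z i ω) (lam n)

/-- `√n` times (2SLS estimator minus `b`) under weak instruments, as a random variable. -/
noncomputable def scaledTwoSLS (β₀ β₁ π₀ c b : ℝ) (Z ε η : ℕ → Ω → ℝ)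
    (n : ℕ) (ω : Ω) : ℝ :=
  √(n : ℝ) *
    (twoSLS n (weakY β₀ β₁ π₀ c (fun i => Z i ω) (fun i => ε i ω) (fun i => η i ω) n)
      (weakD π₀ c (fun i => Z i ω) (fun i => η i ω) n) (fun i => Z i ω) - b)

end RidgeIV

namespace RidgeIV

/-! Write `S_xz` for `crossSum n x z`. Since `π₁ = c / √n`, the signal in `(S_yz - b S_dz) / √n` is
`c (β₁ - b)` times the sample variance of `Z`, hence converges in probability to `c (β₁ - b)`. The
noise is a centred sum of `(β₁ - b) η + ε` against the instrument, and is asymptotically Gaussian.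
Likewise `S_dz / √n` has limit `N(c, Var η)`.

Ridge: `S_dz / n → 0` in probability while `lam n / n → lam₀ > 0`, so the penalty dominates the
denominator and Slutsky's theorem applied to the numerator with `b = 0` gives the limit.

2SLS: `|√n (estimator - b)| ≤ M` forces `|S_yz - b S_dz| / √n ≤ |M| |S_dz| / n` unless `S_dz = 0`.
The left side has a limit law without atom at zero and the right side tends to zero in probability,
so the event has vanishing probability. Only the marginal limits are needed, never the joint law of
numerator and denominator. Escape of mass then excludes every limit law.

The noise CLT is the classical one for stochastic instruments, after replacing the sample mean of
`Z` by its expectation. For fixed instruments it is `tendstoInDistribution_weighted_sum`; the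
negligibility of the weights is not assumed but follows from convergence of the sample variance. -/

/-! ### Characteristic functions and the weighted central limit theorem. -/

theorem norm_prod_sub_prod_le_sum {ι : Type*} (s : Finset ι) (a b : ι → ℂ)
    (ha : ∀ i ∈ s, ‖a i‖ ≤ 1) (hb : ∀ i ∈ s, ‖b i‖ ≤ 1) :
    ‖∏ i ∈ s, a i - ∏ i ∈ s, b i‖ ≤ ∑ i ∈ s, ‖a i - b i‖ := by
  classical
  induction s using Finset.induction_on with
  | empty => simp
  | insert j s hj ih =>
    rw [Finset.prod_insert hj, Finset.prod_insert hj, Finset.sum_insert hj]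
    have h1 : ‖∏ i ∈ s, a i‖ ≤ 1 := by
      rw [norm_prod]
      exact Finset.prod_le_one (fun _ _ => norm_nonneg _)
        fun i hi => ha i (Finset.mem_insert_of_mem hi)
    have h2 := ih (fun i hi => ha i (Finset.mem_insert_of_mem hi))
      fun i hi => hb i (Finset.mem_insert_of_mem hi)
    have h3 := hb j (Finset.mem_insert_self _ _)
    calc ‖a j * ∏ i ∈ s, a i - b j * ∏ i ∈ s, b i‖
        = ‖(a j - b j) * ∏ i ∈ s, a i + b j * (∏ i ∈ s, a i - ∏ i ∈ s, b i)‖ := by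
          congr 1; ring
      _ ≤ ‖a j - b j‖ * ‖∏ i ∈ s, a i‖ + ‖b j‖ * ‖∏ i ∈ s, a i - ∏ i ∈ s, b i‖ := by
          simpa only [norm_mul] using norm_add_le ((a j - b j) * ∏ i ∈ s, a i)
            (b j * (∏ i ∈ s, a i - ∏ i ∈ s, b i))
      _ ≤ ‖a j - b j‖ * 1 + 1 * ∑ i ∈ s, ‖a i - b i‖ := by gcongr
      _ = _ := by ring

/-- Second-order expansion at zero of the characteristic function of a centred square-integrable
law. -/
theorem charFun_sub_isLittleO {μ : Measure ℝ} [IsProbabilityMeasure μ] (hμ : MemLp id 2 μ)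
    (h0 : ∫ x, x ∂μ = 0) :
    (fun t : ℝ => charFun μ t - (1 - ((∫ x, x ^ 2 ∂μ : ℝ) : ℂ) * t ^ 2 / 2)) =o[𝓝 0]
      fun t : ℝ => t ^ 2 := by
  have h := taylorWithinEval_charFun_two_zero (P := μ) (X := id) aemeasurable_id (by simpa using hμ)
  have h' : ∀ t : ℝ, (1 - ((∫ x, x ^ 2 ∂μ : ℝ) : ℂ) * t ^ 2 / 2) =
      taylorWithinEval (charFun μ) 2 Set.univ 0 t := by
    intro t
    rw [Measure.map_id] at h
    rw [h]
    simp [h0]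
  simp_rw [h']
  convert! taylor_isLittleO_univ (f := charFun μ) (x₀ := 0) (n := 2) ?_ using 2 with t
  · simp
  · exact contDiff_charFun hμ

/-- The two laws share mean and variance, so their second-order expansions cancel. Variance zero is
included. -/
theorem charFun_sub_charFun_gaussianReal_isLittleO {μ : Measure ℝ} [IsProbabilityMeasure μ]
    (hμ : MemLp id 2 μ) (h0 : ∫ x, x ∂μ = 0) :
    (fun t : ℝ => charFun μ t - charFun (gaussianReal 0 (variance id μ).toNNReal) t) =o[𝓝 0]
      fun t : ℝ => t ^ 2 := by
  set v := (variance id μ).toNNReal with hv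
  have h1 := charFun_sub_isLittleO hμ h0
  have h2 := charFun_sub_isLittleO (μ := gaussianReal 0 v) (memLp_id_gaussianReal 2)
    (by simp)
  have e1 : ∫ x, x ^ 2 ∂μ = v := by
    rw [hv, Real.coe_toNNReal _ (variance_nonneg _ _), variance_eq_integral aemeasurable_id]
    simp [h0]
  have e2 : ∫ x, x ^ 2 ∂(gaussianReal 0 v) = v := by
    have := variance_id_gaussianReal (μ := 0) (v := v)
    rw [variance_eq_integral aemeasurable_id] at this
    simpa using this
  rw [e1] at h1
  rw [e2] at h2
  simpa using h1.sub h2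

/-- Central limit theorem for weighted sums of iid centred variables with asymptotically
negligible weights. -/
theorem tendstoInDistribution_weighted_sum {Ω : Type*} [MeasurableSpace Ω] {P : Measure Ω}
    [IsProbabilityMeasure P] {X : ℕ → Ω → ℝ} (hindep : iIndepFun X P)
    (hident : ∀ i, IdentDistrib (X i) (X 0) P P) (hX : MemLp (X 0) 2 P) (h0 : P[X 0] = 0)
    {w : ℕ → ℕ → ℝ}
    (hw : Tendsto (fun n => ∑ i ∈ Finset.range n, w n i ^ 2) atTop (𝓝 1))
    (hmax : ∀ δ > 0, ∀ᶠ n in atTop, ∀ i < n, |w n i| < δ) :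
    TendstoInDistribution (fun n ω => ∑ i ∈ Finset.range n, w n i * X i ω) atTop (id : ℝ → ℝ)
      (fun _ => P) (gaussianReal 0 (variance (X 0) P).toNNReal) where
  forall_aemeasurable n :=
    Finset.aemeasurable_fun_sum _ fun i _ => (hident i).aemeasurable_fst.const_mul _
  tendsto := by
    refine ProbabilityMeasure.tendsto_iff_tendsto_charFun.2 fun t => ?_
    have mX (i : ℕ) : AEMeasurable (X i) P := (hident i).aemeasurable_fst
    set μ := P.map (X 0) with hμ
    have : IsProbabilityMeasure μ := Measure.isProbabilityMeasure_map (mX 0)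
    have hvar : variance id μ = variance (X 0) P := by
      rw [hμ, variance_map aemeasurable_id (mX 0)]; rfl
    set G := gaussianReal 0 (variance (X 0) P).toNNReal with hG
    have hlittle : (fun t : ℝ => charFun μ t - charFun G t) =o[𝓝 0] fun t : ℝ => t ^ 2 := by
      rw [hG, ← hvar]
      refine charFun_sub_charFun_gaussianReal_isLittleO ?_ ?_
      · exact (memLp_map_measure_iff (by fun_prop) (mX 0)).2 hX
      · rw [hμ, integral_map (mX 0) (by fun_prop)]; exact h0
    have hchar (n : ℕ) : charFun (P.map fun ω => ∑ i ∈ Finset.range n, w n i * X i ω) t =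
        ∏ i ∈ Finset.range n, charFun μ (w n i * t) := by
      have hi : iIndepFun (fun i ω => w n i * X i ω) P :=
        hindep.comp (fun i x => w n i * x) (by fun_prop)
      rw [(hi.restrict _).charFun_map_fun_finsetSum_eq_prod fun i _ => (mX i).const_mul _]
      simp only [Finset.prod_apply]
      refine Finset.prod_congr rfl fun i _ => ?_
      rw [charFun_map_mul_comp (mX i), (hident i).map_eq]
    -- Independent Gaussians add up to a Gaussian, so the comparison product is a single
    -- characteristic function at a point tending to `t`.
    have hGprod (n : ℕ) : ∏ i ∈ Finset.range n, charFun G (w n i * t) =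
        charFun G (√(∑ i ∈ Finset.range n, w n i ^ 2) * t) := by
      simp only [hG, charFun_gaussianReal]
      rw [← Complex.exp_sum]
      congr 1
      have : ((√(∑ i ∈ Finset.range n, w n i ^ 2) : ℝ) : ℂ) ^ 2 =
          ∑ i ∈ Finset.range n, (w n i : ℂ) ^ 2 := by
        rw [← Complex.ofReal_pow, Real.sq_sqrt (Finset.sum_nonneg fun i _ => sq_nonneg _)]
        push_cast; rfl
      push_cast
      rw [mul_pow, this]
      simp only [Finset.sum_mul, Finset.mul_sum, Finset.sum_div, mul_zero, zero_mul, zero_sub,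
        mul_pow, ← Finset.sum_neg_distrib]
    have hGlim : Tendsto (fun n => ∏ i ∈ Finset.range n, charFun G (w n i * t)) atTop
        (𝓝 (charFun G t)) := by
      simp_rw [hGprod]
      have : Tendsto (fun n => √(∑ i ∈ Finset.range n, w n i ^ 2) * t) atTop (𝓝 t) := by
        simpa using ((Real.continuous_sqrt.tendsto _).comp hw).mul_const t
      exact ((continuous_charFun (μ := G)).tendsto t).comp this
    have hdiff : Tendsto (fun n => ∏ i ∈ Finset.range n, charFun μ (w n i * t) -
        ∏ i ∈ Finset.range n, charFun G (w n i * t)) atTop (𝓝 0) := by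
      rw [Metric.tendsto_nhds]
      intro e he
      -- The squared weights eventually sum to less than `2`, and `t ^ 2 / (t ^ 2 + 1) < 1`; this
      -- constant makes the total error less than `e`.
      have he' : 0 < e / (2 * (t ^ 2 + 1)) := by positivity
      have hb := hlittle.bound he'
      rw [Metric.eventually_nhds_iff] at hb
      obtain ⟨δ, hδ, hb⟩ := hb
      filter_upwards [hmax (δ / (|t| + 1)) (by positivity),
        hw.eventually_lt_const (by norm_num : (1 : ℝ) < 2)] with n hn hn2
      rw [dist_zero_right]
      have key : ∀ i ∈ Finset.range n, ‖charFun μ (w n i * t) - charFun G (w n i * t)‖ ≤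
          e / (2 * (t ^ 2 + 1)) * t ^ 2 * w n i ^ 2 := by
        intro i hi
        have hd : dist (w n i * t) 0 < δ := by
          rw [Real.dist_eq, sub_zero, abs_mul]
          have h1 := hn i (Finset.mem_range.1 hi)
          rw [lt_div_iff₀ (by positivity)] at h1
          nlinarith [abs_nonneg (w n i), abs_nonneg t]
        refine (hb hd).trans_eq ?_
        rw [Real.norm_of_nonneg (sq_nonneg _)]
        ring
      calc _ ≤ ∑ i ∈ Finset.range n, ‖charFun μ (w n i * t) - charFun G (w n i * t)‖ :=
            norm_prod_sub_prod_le_sum _ _ _ (fun _ _ => norm_charFun_le_one _)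
              fun _ _ => norm_charFun_le_one _
        _ ≤ ∑ i ∈ Finset.range n, e / (2 * (t ^ 2 + 1)) * t ^ 2 * w n i ^ 2 :=
            Finset.sum_le_sum key
        _ = e * (t ^ 2 / (t ^ 2 + 1)) * ((∑ i ∈ Finset.range n, w n i ^ 2) / 2) := by
            rw [← Finset.mul_sum]; field_simp
        _ < e := by
            have h1 : t ^ 2 / (t ^ 2 + 1) < 1 := by
              rw [div_lt_one (by positivity)]; linarith
            have h2 : 0 ≤ t ^ 2 / (t ^ 2 + 1) := by positivity
            have h3 : 0 ≤ ∑ i ∈ Finset.range n, w n i ^ 2 :=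
              Finset.sum_nonneg fun i _ => sq_nonneg _
            have h4 : e * (t ^ 2 / (t ^ 2 + 1)) < e := by nlinarith
            have h5 : 0 ≤ e * (t ^ 2 / (t ^ 2 + 1)) := by positivity
            nlinarith
    have := hdiff.add hGlim
    simp only [sub_add_cancel, zero_add] at this
    simpa [hchar, Measure.map_id] using this

/-! ### Slutsky-type tools and escape of mass. -/

theorem _root_.MeasureTheory.TendstoInMeasure.comp_continuousAt {α ι E F : Type*}
    [MeasurableSpace α] {μ : Measure α} [PseudoMetricSpace E] [PseudoMetricSpace F]
    {l : Filter ι} {f : ι → α → E} {c : E}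
    (hf : TendstoInMeasure μ f l fun _ => c) {g : E → F} (hg : ContinuousAt g c) :
    TendstoInMeasure μ (fun i x => g (f i x)) l fun _ => g c := by
  rw [tendstoInMeasure_iff_dist] at hf ⊢
  intro e he
  obtain ⟨δ, hδ, h⟩ := Metric.continuousAt_iff.1 hg e he
  refine tendsto_of_tendsto_of_tendsto_of_le_of_le tendsto_const_nhds (hf δ hδ)
    (fun _ => zero_le) fun i => measure_mono fun x hx => ?_
  by_contra hlt
  exact absurd (h (not_le.1 hlt)) (not_lt.2 hx)

theorem _root_.MeasureTheory.TendstoInMeasure.prodMk {α ι E F : Type*}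
    [MeasurableSpace α] {μ : Measure α} [PseudoMetricSpace E] [PseudoMetricSpace F]
    {l : Filter ι} {f : ι → α → E} {f' : α → E} {g : ι → α → F} {g' : α → F}
    (hf : TendstoInMeasure μ f l f') (hg : TendstoInMeasure μ g l g') :
    TendstoInMeasure μ (fun i x => (f i x, g i x)) l fun x => (f' x, g' x) := by
  rw [tendstoInMeasure_iff_dist] at hf hg ⊢
  intro e he
  have := (hf e he).add (hg e he)
  rw [add_zero] at this
  refine tendsto_of_tendsto_of_tendsto_of_le_of_le tendsto_const_nhds this
    (fun _ => zero_le) fun i => (measure_mono fun x hx => ?_).trans (measure_union_le _ _)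
  simpa [Prod.dist_eq] using hx

theorem tendstoInMeasure_of_tendsto {α : Type*} [MeasurableSpace α] {μ : Measure α}
    [IsFiniteMeasure μ] {r : ℕ → ℝ} {c : ℝ} (h : Tendsto r atTop (𝓝 c)) :
    TendstoInMeasure μ (fun n _ => r n) atTop fun _ => c :=
  tendstoInMeasure_of_tendsto_ae (fun _ => aestronglyMeasurable_const) (ae_of_all _ fun _ => h)

section
variable {Ω Ω' : Type*} [MeasurableSpace Ω] {P : Measure Ω} [IsProbabilityMeasure P]
  [MeasurableSpace Ω'] {Q : Measure Ω'} [IsProbabilityMeasure Q] {X : ℕ → Ω → ℝ} {T : Ω' → ℝ}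

theorem limsup_measure_le_of_tendstoInDistribution
    (h : TendstoInDistribution X atTop T (fun _ => P) Q) {F : Set ℝ} (hF : IsClosed F) :
    limsup (fun n => P {ω | X n ω ∈ F}) atTop ≤ Q.map T F := by
  have := ProbabilityMeasure.limsup_measure_closed_le_of_tendsto h.tendsto hF
  simp only [ProbabilityMeasure.coe_mk] at this
  convert! this using 3 with n
  rw [Measure.map_apply_of_aemeasurable (h.forall_aemeasurable n) hF.measurableSet]
  rfl

theorem le_liminf_measure_of_tendstoInDistribution
    (h : TendstoInDistribution X atTop T (fun _ => P) Q) {G : Set ℝ} (hG : IsOpen G) :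
    Q.map T G ≤ liminf (fun n => P {ω | X n ω ∈ G}) atTop := by
  have := ProbabilityMeasure.le_liminf_measure_open_of_tendsto h.tendsto hG
  simp only [ProbabilityMeasure.coe_mk] at this
  convert! this using 3 with n
  rw [Measure.map_apply_of_aemeasurable (h.forall_aemeasurable n) hG.measurableSet]
  rfl

theorem tendstoInMeasure_mul_of_tendstoInDistribution {Y : ℕ → Ω → ℝ}
    (hX : TendstoInDistribution X atTop T (fun _ => P) Q)
    (hY : TendstoInMeasure P Y atTop fun _ => 0) (hYm : ∀ n, AEMeasurable (Y n) P) :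
    TendstoInMeasure P (fun n ω => X n ω * Y n ω) atTop fun _ => 0 := by
  have h := hX.continuous_comp_prodMk_of_tendstoInMeasure_const
    (g := fun p : ℝ × ℝ => p.1 * p.2) (by fun_prop) hY hYm
  rw [tendstoInMeasure_iff_dist]
  intro e he
  have hc : IsClosed {x : ℝ | e ≤ dist x 0} :=
    isClosed_le continuous_const (continuous_id.dist continuous_const)
  have h2 := limsup_measure_le_of_tendstoInDistribution h hc
  rw [Measure.map_apply_of_aemeasurable h.aemeasurable_limit hc.measurableSet] at h2
  have h3 : Q ((fun ω => T ω * 0) ⁻¹' {x : ℝ | e ≤ dist x 0}) = 0 := by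
    simp [he.not_ge, Set.preimage]
  refine tendsto_of_le_liminf_of_limsup_le zero_le (h2.trans_eq h3)

/-- If `X n` converges in distribution to a law without atom at zero, while `Y n → 0` in
probability, then eventually `|X n| > |Y n|` with high probability. -/
theorem tendsto_measure_abs_le_abs_of_tendstoInDistribution {Y : ℕ → Ω → ℝ}
    (hX : TendstoInDistribution X atTop T (fun _ => P) Q) (h0 : Q.map T {0} = 0)
    (hY : TendstoInMeasure P Y atTop fun _ => 0) (hYm : ∀ n, AEMeasurable (Y n) P) :
    Tendsto (fun n => P {ω | |X n ω| ≤ |Y n ω|}) atTop (𝓝 0) := by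
  -- The event `|X n| ≤ |Y n|` is exactly the vanishing of this continuous function, hence a closed
  -- event to which the portmanteau bound applies.
  have h := hX.continuous_comp_prodMk_of_tendstoInMeasure_const
    (g := fun p : ℝ × ℝ => max (|p.1| - |p.2|) 0) (by fun_prop) hY hYm
  have h2 := limsup_measure_le_of_tendstoInDistribution h (isClosed_singleton (x := (0 : ℝ)))
  rw [Measure.map_apply_of_aemeasurable h.aemeasurable_limit (measurableSet_singleton _)] at h2
  rw [Measure.map_apply_of_aemeasurable hX.aemeasurable_limit (measurableSet_singleton _)] at h0
  have h3 : (fun ω => max (|T ω| - |(0 : ℝ)|) 0) ⁻¹' {0} = T ⁻¹' {0} := by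
    ext ω; simp
  rw [h3, h0] at h2
  refine tendsto_of_le_liminf_of_limsup_le zero_le ?_
  simpa using h2

/-- A sequence escaping to infinity in probability has no limit in distribution. -/
theorem not_tendstoInDistribution_of_escape
    (hX : ∀ M : ℝ, Tendsto (fun n => P {ω | |X n ω| ≤ M}) atTop (𝓝 0)) :
    ¬ TendstoInDistribution X atTop T (fun _ => P) Q := by
  intro h
  have hp : IsProbabilityMeasure (Q.map T) := Measure.isProbabilityMeasure_map h.aemeasurable_limit
  have hz : ∀ k : ℕ, Q.map T (Metric.ball 0 k) = 0 := by
    intro k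
    have h1 := le_liminf_measure_of_tendstoInDistribution h (Metric.isOpen_ball (x := 0) (ε := k))
    refine le_antisymm (h1.trans ?_) zero_le
    rw [← (hX k).liminf_eq]
    refine liminf_le_liminf (Eventually.of_forall fun n => measure_mono fun ω hω => ?_)
    simpa using (mem_ball_zero_iff.1 hω).le
  have h2 : Q.map T Set.univ = 0 := by
    rw [← Metric.iUnion_ball_nat (0 : ℝ)]
    exact measure_iUnion_null hz
  simp at h2

end

/-! ### Algebra of centred sums and negligibility of the weights. -/

theorem sum_sub_sampleMean (n : ℕ) (z : ℕ → ℝ) :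
    ∑ i ∈ Finset.range n, (z i - sampleMean n z) = 0 := by
  rcases Nat.eq_zero_or_pos n with rfl | hn
  · simp
  · have : (n : ℝ) ≠ 0 := by positivity
    simp [sampleMean]
    field_simp
    simp

/-- The centred instruments sum to zero, so the centring of `x` is immaterial. -/
theorem crossSum_eq_sum_sub_mul (n : ℕ) (x z : ℕ → ℝ) (a : ℝ) :
    crossSum n x z = ∑ i ∈ Finset.range n, (x i - a) * (z i - sampleMean n z) := by
  have h (r : ℝ) : ∑ i ∈ Finset.range n, (x i - r) * (z i - sampleMean n z) =
      ∑ i ∈ Finset.range n, x i * (z i - sampleMean n z) := by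
    simp only [sub_mul (x _) r]
    rw [Finset.sum_sub_distrib, ← Finset.mul_sum, sum_sub_sampleMean, mul_zero, sub_zero]
  rw [crossSum, h, h]

theorem crossSum_affine (n : ℕ) (a b : ℝ) (z u : ℕ → ℝ) :
    crossSum n (fun i => a + b * z i + u i) z = b * crossSum n z z + crossSum n u z := by
  rw [crossSum_eq_sum_sub_mul n _ z a, crossSum_eq_sum_sub_mul n z z 0,
    crossSum_eq_sum_sub_mul n u z 0, Finset.mul_sum, ← Finset.sum_add_distrib]
  exact Finset.sum_congr rfl fun i _ => by ring

theorem crossSum_self (n : ℕ) (z : ℕ → ℝ) :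
    crossSum n z z = ∑ i ∈ Finset.range n, z i ^ 2 - (∑ i ∈ Finset.range n, z i) ^ 2 / n := by
  rw [crossSum_eq_sum_sub_mul n z z 0]
  simp only [sub_zero, mul_sub]
  rw [Finset.sum_sub_distrib, ← Finset.sum_mul, sampleMean]
  congr 1
  · exact Finset.sum_congr rfl fun i _ => by ring
  · ring

theorem sum_sq_sub_sampleMean (n : ℕ) (z : ℕ → ℝ) :
    ∑ i ∈ Finset.range n, (z i - sampleMean n z) ^ 2 = crossSum n z z :=
  Finset.sum_congr rfl fun _ _ => sq _

theorem crossSum_self_succ {n : ℕ} (hn : n ≠ 0) (z : ℕ → ℝ) :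
    crossSum (n + 1) z z = crossSum n z z + n / (n + 1) * (z n - sampleMean n z) ^ 2 := by
  have : (n : ℝ) ≠ 0 := by positivity
  have : (n + 1 : ℝ) ≠ 0 := by positivity
  rw [crossSum_self, crossSum_self, Finset.sum_range_succ, Finset.sum_range_succ, sampleMean]
  push_cast
  field_simp
  ring

/-- Cauchy–Schwarz on the first `m` deviations from the full mean. It limits the drift of the
running mean. -/
theorem mul_sq_sampleMean_sub_le {m n : ℕ} (hmn : m ≤ n) (z : ℕ → ℝ) :
    m * (sampleMean m z - sampleMean n z) ^ 2 ≤ crossSum n z z := by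
  rcases Nat.eq_zero_or_pos m with rfl | hm
  · simp only [Nat.cast_zero, zero_mul]
    rw [← sum_sq_sub_sampleMean]
    exact Finset.sum_nonneg fun _ _ => sq_nonneg _
  have hm' : (0 : ℝ) < m := by positivity
  have h1 : (m : ℝ) * (sampleMean m z - sampleMean n z) =
      ∑ i ∈ Finset.range m, (z i - sampleMean n z) := by
    simp [sampleMean]
    field_simp
  have h2 := sq_sum_le_card_mul_sum_sq (s := Finset.range m) (f := fun i => z i - sampleMean n z)
  rw [← h1, Finset.card_range] at h2
  have h3 : ∑ i ∈ Finset.range m, (z i - sampleMean n z) ^ 2 ≤ crossSum n z z := by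
    rw [← sum_sq_sub_sampleMean]
    exact Finset.sum_le_sum_of_subset_of_nonneg (Finset.range_subset_range.2 hmn)
      fun _ _ _ => sq_nonneg _
  refine le_trans ?_ h3
  refine le_of_mul_le_mul_left ?_ hm'
  linarith

theorem tendsto_sq_sub_sampleMean_div {z : ℕ → ℝ}
    (hz : Tendsto (fun n => sampleCov n z z) atTop (𝓝 1)) :
    Tendsto (fun n : ℕ => (z n - sampleMean n z) ^ 2 / n) atTop (𝓝 0) := by
  have h1 : Tendsto (fun n : ℕ => ((n : ℝ) + 1) / n) atTop (𝓝 1) := by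
    have : Tendsto (fun n : ℕ => 1 + 1 / (n : ℝ)) atTop (𝓝 (1 + 0)) :=
      tendsto_const_nhds.add tendsto_one_div_atTop_nhds_zero_nat
    rw [add_zero] at this
    refine this.congr' ?_
    filter_upwards [eventually_ne_atTop 0] with n hn
    have : (n : ℝ) ≠ 0 := by positivity
    field_simp
  -- By the one-step update `crossSum_self_succ`, the new squared deviation is a rescaled increment
  -- of the centred sum of squares, which is `o(n)`.
  have h2 := ((((hz.comp (tendsto_add_atTop_nat 1)).mul h1).sub hz).mul h1)
  norm_num at h2
  refine h2.congr' ?_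
  filter_upwards [eventually_ne_atTop 0] with n hn
  have : (n : ℝ) ≠ 0 := by positivity
  have : (n + 1 : ℝ) ≠ 0 := by positivity
  simp only [sampleCov, crossSum_self_succ hn]
  push_cast
  field_simp
  ring

/-- Convergence of the sample variance forces the centred observations to be uniformly negligible
at scale `√n`. -/
theorem eventually_forall_abs_sub_sampleMean_div_lt {z : ℕ → ℝ}
    (hz : Tendsto (fun n => sampleCov n z z) atTop (𝓝 1)) :
    ∀ δ > 0, ∀ᶠ n : ℕ in atTop, ∀ i < n, |(z i - sampleMean n z) / √(n : ℝ)| < δ := by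
  intro δ hδ
  -- Beyond `K`, each observation is close to its own running mean at scale `√i`; the bound on `2 /
  -- K` controls the drift of the running means.
  obtain ⟨K, hK0, hKδ, hKd⟩ : ∃ K : ℕ, 0 < K ∧ 2 / (K : ℝ) < (δ / 4) ^ 2 ∧
      ∀ i ≥ K, (z i - sampleMean i z) ^ 2 / i < (δ / 4) ^ 2 := by
    have e1 := (tendsto_sq_sub_sampleMean_div hz).eventually_lt_const
      (by positivity : (0 : ℝ) < (δ / 4) ^ 2)
    have e2 : ∀ᶠ n : ℕ in atTop, 2 / (n : ℝ) < (δ / 4) ^ 2 :=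
      (tendsto_const_div_atTop_nhds_zero_nat 2).eventually_lt_const (by positivity)
    obtain ⟨K, h⟩ := eventually_atTop.1 (e1.and (e2.and (eventually_gt_atTop 0)))
    exact ⟨K, (h K le_rfl).2.2, (h K le_rfl).2.1, fun i hi => (h i hi).1⟩
  set C := ∑ j ∈ Finset.range K, |z j - sampleMean K z| with hC
  have e3 : ∀ᶠ n : ℕ in atTop, C < δ / 4 * √(n : ℝ) :=
    ((Real.tendsto_sqrt_atTop.comp tendsto_natCast_atTop_atTop).const_mul_atTop
      (by positivity)).eventually_gt_atTop C
  filter_upwards [e3, hz.eventually_lt_const (by norm_num : (1 : ℝ) < 2), eventually_ge_atTop K]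
    with n hn hS hnK i hi
  have hnpos : (0 : ℝ) < n := by exact_mod_cast hK0.trans_le hnK
  have hs : 0 < √(n : ℝ) := Real.sqrt_pos.2 hnpos
  have hsq : √(n : ℝ) ^ 2 = n := Real.sq_sqrt hnpos.le
  have hmean : ∀ m, K ≤ m → m ≤ n → |sampleMean m z - sampleMean n z| ≤ δ / 4 * √(n : ℝ) := by
    intro m hKm hmn
    refine abs_le_of_sq_le_sq ?_ (by positivity)
    have hm : (0 : ℝ) < m := by exact_mod_cast hK0.trans_le hKm
    have h1 := mul_sq_sampleMean_sub_le hmn z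
    rw [sampleCov, div_lt_iff₀ hnpos] at hS
    have hKp : (0 : ℝ) < K := by exact_mod_cast hK0
    have h2 : (K : ℝ) ≤ m := by exact_mod_cast hKm
    rw [div_lt_iff₀ hKp] at hKδ
    rw [mul_pow, hsq]
    have h4 : (δ / 4) ^ 2 * K ≤ (δ / 4) ^ 2 * m := by gcongr
    have h5 : 2 * (n : ℝ) ≤ (δ / 4) ^ 2 * m * n := by nlinarith
    refine le_of_mul_le_mul_left ?_ hm
    linarith
  -- Late indices are compared with their own running mean, and the finitely many early ones with
  -- the mean at `K`, where the fixed constant `C` suffices. Adding the drift gives at most `δ / 2`.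
  have hfirst : |z i - sampleMean (max i K) z| ≤ δ / 4 * √(n : ℝ) := by
    rcases le_or_gt K i with h | h
    · rw [max_eq_left h]
      have hip : (0 : ℝ) < i := by exact_mod_cast hK0.trans_le h
      have h1 := hKd i h
      rw [div_lt_iff₀ hip] at h1
      refine abs_le_of_sq_le_sq ?_ (by positivity)
      rw [mul_pow, hsq]
      have : (i : ℝ) ≤ n := by exact_mod_cast hi.le
      have h4 : (δ / 4) ^ 2 * i ≤ (δ / 4) ^ 2 * n := by gcongr
      linarith
    · rw [max_eq_right h.le]
      refine le_trans ?_ hn.le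
      exact Finset.single_le_sum (f := fun j => |z j - sampleMean K z|)
        (fun _ _ => abs_nonneg _) (Finset.mem_range.2 h)
  rw [abs_div, abs_of_pos hs, div_lt_iff₀ hs]
  have h6 := abs_sub_le (z i) (sampleMean (max i K) z) (sampleMean n z)
  have h7 := hmean (max i K) (le_max_right _ _) (max_le hi.le hnK)
  nlinarith

/-! ### The noise limit under both instrument designs. -/

section
variable {Ω : Type*} [MeasurableSpace Ω] {P : Measure Ω}
  {Z ε η : ℕ → Ω → ℝ}

theorem IIDErrors.memLp_linear (h : IIDErrors P ε η) (a b : ℝ) :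
    MemLp (fun ω => a * η 0 ω + b * ε 0 ω) 2 P :=
  (h.memLp_eta.const_mul a).add (h.memLp_eps.const_mul b)

theorem IIDErrors.iIndepFun_linear (h : IIDErrors P ε η) (a b : ℝ) :
    iIndepFun (fun i ω => a * η i ω + b * ε i ω) P :=
  h.indep.comp (fun _ p => a * p.2 + b * p.1) (by fun_prop)

theorem IIDErrors.identDistrib_linear (h : IIDErrors P ε η) (a b : ℝ) (i : ℕ) :
    IdentDistrib (fun ω => a * η i ω + b * ε i ω) (fun ω => a * η 0 ω + b * ε 0 ω) P P :=
  (h.ident i).comp (u := fun p : ℝ × ℝ => a * p.2 + b * p.1) (by fun_prop)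

theorem FixedInstruments.measurable (hZ : FixedInstruments Z) (i : ℕ) : Measurable (Z i) := by
  obtain ⟨z, hz, -⟩ := hZ
  rw [show Z i = fun _ => z i from funext (hz i)]
  exact measurable_const

theorem StochasticInstruments.identDistrib_Z (hZ : StochasticInstruments P Z ε η) (i : ℕ) :
    IdentDistrib (Z i) (Z 0) P P :=
  (hZ.ident i).comp (u := fun p : ℝ × ℝ × ℝ => p.1) (by fun_prop)

theorem StochasticInstruments.iIndepFun_Z (hZ : StochasticInstruments P Z ε η) :
    iIndepFun Z P :=
  hZ.indep.comp (fun _ p => p.1) (by fun_prop)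

theorem measurable_sampleMean (hZ : ∀ i, Measurable (Z i)) (n : ℕ) :
    Measurable fun ω => sampleMean n fun i => Z i ω := by
  unfold sampleMean
  fun_prop

theorem measurable_crossSum {X : ℕ → Ω → ℝ} (hX : ∀ i, Measurable (X i))
    (hZ : ∀ i, Measurable (Z i)) (n : ℕ) :
    Measurable fun ω => crossSum n (fun i => X i ω) fun i => Z i ω := by
  have := measurable_sampleMean hX n
  have := measurable_sampleMean hZ n
  unfold crossSum
  fun_prop

theorem measurable_sampleCov (hZ : ∀ i, Measurable (Z i)) (n : ℕ) :
    Measurable fun ω => sampleCov n (fun i => Z i ω) fun i => Z i ω :=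
  (measurable_crossSum hZ hZ n).div_const _

variable [IsProbabilityMeasure P]

theorem FixedInstruments.tendstoInMeasure_sampleCov (hZ : FixedInstruments Z) :
    TendstoInMeasure P (fun n ω => sampleCov n (fun i => Z i ω) fun i => Z i ω) atTop
      fun _ => 1 := by
  obtain ⟨z, hz, h⟩ := hZ
  simp only [hz]
  exact tendstoInMeasure_of_tendsto h

/-- The weights are `(z i - z̄) / √n`, whose squares sum to the sample variance. -/
theorem FixedInstruments.tendstoInDistribution_crossSum (hZ : FixedInstruments Z)
    (h : IIDErrors P ε η) (a b : ℝ) :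
    TendstoInDistribution
      (fun (n : ℕ) ω => crossSum n (fun i => a * η i ω + b * ε i ω) (fun i => Z i ω) / √(n : ℝ))
      atTop (id : ℝ → ℝ) (fun _ => P)
      (gaussianReal 0 (variance (fun ω => a * η 0 ω + b * ε 0 ω) P).toNNReal) := by
  obtain ⟨z, hz, hcov⟩ := hZ
  simp only [hz]
  set U : ℕ → Ω → ℝ := fun i ω => a * η i ω + b * ε i ω with hU
  set μ := P[U 0] with hμ
  have hL : MemLp (U 0) 2 P := h.memLp_linear a b
  have hm : AEMeasurable (U 0) P := hL.1.aemeasurable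
  have key := tendstoInDistribution_weighted_sum (P := P) (X := fun i ω => U i ω - μ)
    (w := fun n i => (z i - sampleMean n z) / √(n : ℝ))
    ((h.iIndepFun_linear a b).comp (fun _ x => x - μ) (by fun_prop))
    (fun i => (h.identDistrib_linear a b i).comp (u := fun x => x - μ) (by fun_prop))
    (hL.sub (memLp_const μ))
    (by rw [integral_sub (hL.integrable (by simp)) (by simp)]; simp [hμ])
    (by
      refine hcov.congr fun n => ?_
      simp only [div_pow, Real.sq_sqrt (Nat.cast_nonneg n)]
      rw [← Finset.sum_div, sum_sq_sub_sampleMean, sampleCov])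
    (eventually_forall_abs_sub_sampleMean_div_lt hcov)
  rw [variance_sub_const hm.aestronglyMeasurable] at key
  refine key.congr (fun n => .of_forall fun ω => ?_) .rfl
  simp only
  rw [crossSum_eq_sum_sub_mul n _ z μ, Finset.sum_div]
  exact Finset.sum_congr rfl fun i _ => by simp only [hU]; ring

theorem StochasticInstruments.memLp_two (hZ : StochasticInstruments P Z ε η) :
    MemLp (Z 0) 2 P :=
  hZ.memLp.mono_exponent (by norm_num)

theorem StochasticInstruments.ae_tendsto_sampleMean (hZ : StochasticInstruments P Z ε η) :
    ∀ᵐ ω ∂P, Tendsto (fun n => sampleMean n fun i => Z i ω) atTop (𝓝 P[Z 0]) :=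
  strong_law_ae_real Z (hZ.memLp_two.integrable (by simp))
    (fun _ _ hij => hZ.iIndepFun_Z.indepFun hij) hZ.identDistrib_Z

theorem StochasticInstruments.tendstoInMeasure_sampleCov (hZ : StochasticInstruments P Z ε η) :
    TendstoInMeasure P (fun n ω => sampleCov n (fun i => Z i ω) fun i => Z i ω) atTop
      fun _ => 1 := by
  refine tendstoInMeasure_of_tendsto_ae
    (fun n => (measurable_sampleCov hZ.measurable n).aestronglyMeasurable) ?_
  have hsq := strong_law_ae_real (μ := P) (fun i ω => Z i ω ^ 2) hZ.memLp_two.integrable_sq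
    (fun i j hij => (hZ.iIndepFun_Z.indepFun hij).comp (φ := fun x => x ^ 2) (ψ := fun x => x ^ 2)
      (by fun_prop) (by fun_prop))
    (fun i => (hZ.identDistrib_Z i).comp (u := fun x => x ^ 2) (by fun_prop))
  filter_upwards [hsq, hZ.ae_tendsto_sampleMean] with ω h1 h2
  have h3 := h1.sub (h2.pow 2)
  have hv : ∫ ω, Z 0 ω ^ 2 ∂P - P[Z 0] ^ 2 = 1 := by
    rw [← hZ.variance_eq, variance_eq_sub hZ.memLp_two]
    rfl
  rw [hv] at h3
  refine h3.congr fun n => ?_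
  rw [sampleCov, crossSum_self, sampleMean]
  rcases Nat.eq_zero_or_pos n with rfl | hn
  · simp
  · have : (n : ℝ) ≠ 0 := by positivity
    field_simp

/-- With `Z` centred at its expectation the summands are iid, and independence with `Var Z = 1`
leaves the variance of `U` unchanged. The correction is a normalised sum of `U - μ`, convergent in
distribution, times `m - Z̄ → 0`. -/
theorem StochasticInstruments.tendstoInDistribution_crossSum
    (hZ : StochasticInstruments P Z ε η) (h : IIDErrors P ε η) (a b : ℝ) :
    TendstoInDistribution
      (fun (n : ℕ) ω => crossSum n (fun i => a * η i ω + b * ε i ω) (fun i => Z i ω) / √(n : ℝ))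
      atTop (id : ℝ → ℝ) (fun _ => P)
      (gaussianReal 0 (variance (fun ω => a * η 0 ω + b * ε 0 ω) P).toNNReal) := by
  set U : ℕ → Ω → ℝ := fun i ω => a * η i ω + b * ε i ω with hU
  have hUm (i : ℕ) : Measurable (U i) :=
    ((h.measurable_eta i).const_mul a).add ((h.measurable_eps i).const_mul b)
  set μ := P[U 0] with hμ
  set m := P[Z 0] with hm
  have hL : MemLp (U 0) 2 P := h.memLp_linear a b
  set V : ℕ → Ω → ℝ := fun i ω => (U i ω - μ) * (Z i ω - m) with hV
  have hA : MemLp (fun ω => U 0 ω - μ) 2 P := hL.sub (memLp_const μ)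
  have hB : MemLp (fun ω => Z 0 ω - m) 2 P := hZ.memLp_two.sub (memLp_const m)
  have hAB : IndepFun (fun ω => U 0 ω - μ) (fun ω => Z 0 ω - m) P :=
    (hZ.exogenous 0).symm.comp (φ := fun p : ℝ × ℝ => a * p.2 + b * p.1 - μ)
      (ψ := fun x => x - m) (by fun_prop) (by fun_prop)
  have hAB2 : IndepFun (fun ω => (U 0 ω - μ) ^ 2) (fun ω => (Z 0 ω - m) ^ 2) P :=
    hAB.comp (φ := fun x => x ^ 2) (ψ := fun x => x ^ 2) (by fun_prop) (by fun_prop)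
  have hVmeas (i : ℕ) : Measurable (V i) := ((hUm i).sub_const μ).mul ((hZ.measurable i).sub_const m)
  have hVL : MemLp (V 0) 2 P := by
    refine (memLp_two_iff_integrable_sq (hVmeas 0).aestronglyMeasurable).2 ?_
    simp only [hV, mul_pow]
    exact hAB2.integrable_mul hA.integrable_sq hB.integrable_sq
  have hV0 : P[V 0] = 0 := by
    have h1 : ∫ ω, (U 0 ω - μ) ∂P = 0 := by
      rw [integral_sub (hL.integrable (by simp)) (by simp)]; simp [hμ]
    have := hAB.integral_fun_mul_eq_mul_integral hA.1 hB.1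
    rw [h1, zero_mul] at this
    exact this
  have hVvar : variance (V 0) P = variance (U 0) P := by
    have hZv := hZ.variance_eq
    rw [variance_eq_integral (hZ.measurable 0).aemeasurable] at hZv
    rw [variance_eq_integral (hVmeas 0).aemeasurable, variance_eq_integral (hUm 0).aemeasurable,
      hV0]
    have := hAB2.integral_fun_mul_eq_mul_integral hA.integrable_sq.1 hB.integrable_sq.1
    rw [hZv, mul_one] at this
    rw [← this]
    simp only [hV, sub_zero, mul_pow]
  have hVclt := tendstoInDistribution_inv_sqrt_mul_sum_sub (P := P) (X := V)
    (P' := gaussianReal 0 (variance (U 0) P).toNNReal) (Y := id)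
    (by rw [hVvar]; exact HasLaw.id) hVL
    (hZ.indep.comp (fun _ p => (a * p.2.2 + b * p.2.1 - μ) * (p.1 - m)) (by fun_prop))
    (fun i => (hZ.ident i).comp
      (u := fun p : ℝ × ℝ × ℝ => (a * p.2.2 + b * p.2.1 - μ) * (p.1 - m)) (by fun_prop))
  have hUclt := tendstoInDistribution_inv_sqrt_mul_sum_sub (P := P) (X := U)
    (P' := gaussianReal 0 (variance (U 0) P).toNNReal) (Y := id) HasLaw.id hL
    (h.iIndepFun_linear a b) (h.identDistrib_linear a b)
  have hzm := measurable_sampleMean hZ.measurable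
  have hmean : TendstoInMeasure P (fun n ω => m - sampleMean n fun i => Z i ω) atTop
      fun _ => 0 := by
    refine tendstoInMeasure_of_tendsto_ae
      (fun n => ((hzm n).const_sub m).aestronglyMeasurable) ?_
    filter_upwards [hZ.ae_tendsto_sampleMean] with ω hω
    simpa [hm] using hω.const_sub m
  refine tendstoInDistribution_of_tendstoInMeasure_sub _ _ hVclt ?_
    fun n => ((measurable_crossSum hUm hZ.measurable n).div_const _).aemeasurable
  refine (tendstoInMeasure_mul_of_tendstoInDistribution hUclt hmean
    fun n => ((hzm n).const_sub m).aemeasurable).congr (fun n => .of_forall fun ω => ?_) .rfl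
  simp only [Pi.sub_apply]
  rw [hV0, crossSum_eq_sum_sub_mul n _ _ μ]
  have e1 : ∑ i ∈ Finset.range n, (U i ω - μ) * (Z i ω - sampleMean n fun i => Z i ω) =
      ∑ i ∈ Finset.range n, V i ω +
        (∑ i ∈ Finset.range n, U i ω - n * μ) * (m - sampleMean n fun i => Z i ω) := by
    have : ∑ i ∈ Finset.range n, U i ω - n * μ = ∑ i ∈ Finset.range n, (U i ω - μ) := by simp
    rw [this, Finset.sum_mul, ← Finset.sum_add_distrib]
    exact Finset.sum_congr rfl fun i _ => by simp only [hV]; ring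
  change _ = (∑ i ∈ Finset.range n, (U i ω - μ) * (Z i ω - sampleMean n fun i => Z i ω)) / _ - _
  rw [e1, div_eq_inv_mul, ← hμ]
  ring

end

/-! ### Reduction of the estimators to signal plus noise. -/

theorem crossSum_weakD (n : ℕ) (π₀ c : ℝ) (z η : ℕ → ℝ) :
    crossSum n (weakD π₀ c z η n) z = weakCoef c n * crossSum n z z + crossSum n η z :=
  crossSum_affine n π₀ (weakCoef c n) z η

theorem crossSum_weakY_sub (n : ℕ) (β₀ β₁ π₀ c b : ℝ) (z ε η : ℕ → ℝ) :
    crossSum n (weakY β₀ β₁ π₀ c z ε η n) z - b * crossSum n (weakD π₀ c z η n) z =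
      weakCoef c n * (β₁ - b) * crossSum n z z +
        crossSum n (fun i => (β₁ - b) * η i + 1 * ε i) z := by
  have h1 : weakY β₀ β₁ π₀ c z ε η n = fun i =>
      (β₀ + β₁ * π₀) + (β₁ * weakCoef c n) * z i + (β₁ * η i + ε i) := by
    ext i; simp only [weakY, weakD, outcome, firstStage]; ring
  rw [crossSum_weakD, h1, crossSum_affine]
  simp only [crossSum_eq_sum_sub_mul n _ z 0, sub_zero]
  simp only [mul_add, ← sub_sub, Finset.mul_sum, ← Finset.sum_add_distrib,
    ← Finset.sum_sub_distrib]
  exact Finset.sum_congr rfl fun i _ => by ring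

/-- `(crossSum Y Z - b * crossSum D Z) / √n` in terms of the sample variance of the instrument and
the composite error. -/
theorem crossSum_weakY_sub_div_sqrt (n : ℕ) (β₀ β₁ π₀ c b : ℝ) (z ε η : ℕ → ℝ) :
    (crossSum n (weakY β₀ β₁ π₀ c z ε η n) z - b * crossSum n (weakD π₀ c z η n) z) / √(n : ℝ) =
      crossSum n (fun i => (β₁ - b) * η i + 1 * ε i) z / √(n : ℝ) +
        c * (β₁ - b) * sampleCov n z z := by
  rw [crossSum_weakY_sub, weakCoef, sampleCov]
  have e : crossSum n z z / √(n : ℝ) / √(n : ℝ) = crossSum n z z / n := by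
    rw [div_div, Real.mul_self_sqrt (Nat.cast_nonneg n)]
  rw [add_div, ← e]
  ring

theorem crossSum_weakD_div_sqrt (n : ℕ) (π₀ c : ℝ) (z η : ℕ → ℝ) :
    crossSum n (weakD π₀ c z η n) z / √(n : ℝ) =
      crossSum n η z / √(n : ℝ) + c * sampleCov n z z := by
  rw [crossSum_weakD, weakCoef, sampleCov]
  have e : crossSum n z z / √(n : ℝ) / √(n : ℝ) = crossSum n z z / n := by
    rw [div_div, Real.mul_self_sqrt (Nat.cast_nonneg n)]
  rw [add_div, ← e]
  ring

section
variable {Ω : Type*} [MeasurableSpace Ω] {P : Measure Ω} [IsProbabilityMeasure P]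
  {Z ε η : ℕ → Ω → ℝ}

theorem tendstoInDistribution_id_of_map_eq {Ω' : Type*} [MeasurableSpace Ω'] {Q : Measure Ω'}
    [IsProbabilityMeasure Q] {X : ℕ → Ω → ℝ} {T : Ω' → ℝ} {ν : Measure ℝ}
    [IsProbabilityMeasure ν] (h : TendstoInDistribution X atTop T (fun _ => P) Q)
    (hT : Q.map T = ν) : TendstoInDistribution X atTop (id : ℝ → ℝ) (fun _ => P) ν where
  forall_aemeasurable := h.forall_aemeasurable
  tendsto := by
    have := h.tendsto
    simpa only [hT, Measure.map_id] using this

/-- Adding a multiple of a sequence that tends to one in probability shifts a Gaussian limit. -/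
theorem tendstoInDistribution_add_mul_gaussianReal {X W : ℕ → Ω → ℝ} {v : NNReal} (a : ℝ)
    (hX : TendstoInDistribution X atTop (id : ℝ → ℝ) (fun _ => P) (gaussianReal 0 v))
    (hW : TendstoInMeasure P W atTop fun _ => 1) (hWm : ∀ n, AEMeasurable (W n) P) :
    TendstoInDistribution (fun n ω => X n ω + a * W n ω) atTop (id : ℝ → ℝ) (fun _ => P)
      (gaussianReal a v) := by
  refine tendstoInDistribution_id_of_map_eq (hX.continuous_comp_prodMk_of_tendstoInMeasure_const
    (g := fun p : ℝ × ℝ => p.1 + a * p.2) (by fun_prop) hW hWm) ?_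
  simpa using gaussianReal_map_add_const (μ := 0) (v := v) a

theorem tendstoInMeasure_inv_sqrt :
    TendstoInMeasure P (fun (n : ℕ) _ => 1 / √(n : ℝ)) atTop fun _ => (0 : ℝ) := by
  refine tendstoInMeasure_of_tendsto ?_
  simp only [one_div]
  exact tendsto_inv_atTop_zero.comp (Real.tendsto_sqrt_atTop.comp tendsto_natCast_atTop_atTop)

end

end RidgeIV

/-! ### The limits of ridge and 2SLS. -/

open RidgeIV in
theorem mainTheorem1 {Ω : Type*} [MeasurableSpace Ω] (P : Measure Ω) [IsProbabilityMeasure P]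
    (Z ε η : ℕ → Ω → ℝ) (β₀ β₁ π₀ c : ℝ)
    (herr : RidgeIV.IIDErrors P ε η)
    (hZ : RidgeIV.FixedInstruments Z ∨ RidgeIV.StochasticInstruments P Z ε η)
    (lam : ℕ → ℝ) (lam₀ : ℝ) (hlam₀ : 0 < lam₀)
    (hlam : Tendsto (fun n : ℕ => lam n / (n : ℝ)) atTop (𝓝 lam₀)) :
    TendstoInDistribution (RidgeIV.scaledRidge β₀ β₁ π₀ c lam Z ε η) atTop (id : ℝ → ℝ)
        (fun _ => P)
        (gaussianReal (c * β₁ / lam₀)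
          (variance (fun ω => β₁ * η 0 ω + ε 0 ω) P / lam₀ ^ 2).toNNReal) ∧
      (0 < variance (η 0) P →
        ∀ b : ℝ, 0 < variance (fun ω => (β₁ - b) * η 0 ω + ε 0 ω) P →
          (∀ M : ℝ, Tendsto
            (fun n => P {ω | |RidgeIV.scaledTwoSLS β₀ β₁ π₀ c b Z ε η n ω| ≤ M})
            atTop (𝓝 0)) ∧
          ∀ (ν : Measure ℝ) [IsProbabilityMeasure ν],
            ¬ TendstoInDistribution (RidgeIV.scaledTwoSLS β₀ β₁ π₀ c b Z ε η) atTop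
              (id : ℝ → ℝ) (fun _ => P) ν) := by
  have hZm : ∀ i, Measurable (Z i) := hZ.elim (fun h => h.measurable) fun h => h.measurable
  have hcov : TendstoInMeasure P (fun n ω => sampleCov n (fun i => Z i ω) fun i => Z i ω) atTop
      fun _ => 1 :=
    hZ.elim (fun h => h.tendstoInMeasure_sampleCov) fun h => h.tendstoInMeasure_sampleCov
  have hcovm (n : ℕ) : AEMeasurable (fun ω => sampleCov n (fun i => Z i ω) fun i => Z i ω) P :=
    (measurable_sampleCov hZm n).aemeasurable
  have hclt (a b : ℝ) := hZ.elim (fun h => h.tendstoInDistribution_crossSum herr a b)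
    fun h => h.tendstoInDistribution_crossSum herr a b
  have hD : TendstoInDistribution (fun (n : ℕ) ω =>
      crossSum n (weakD π₀ c (fun i => Z i ω) (fun i => η i ω) n) (fun i => Z i ω) / √(n : ℝ))
      atTop (id : ℝ → ℝ) (fun _ => P) (gaussianReal c (variance (η 0) P).toNNReal) := by
    simp only [crossSum_weakD_div_sqrt]
    exact tendstoInDistribution_add_mul_gaussianReal c (by simpa using hclt 1 0) hcov hcovm
  have hA (b : ℝ) : TendstoInDistribution (fun (n : ℕ) ω =>
      (crossSum n (weakY β₀ β₁ π₀ c (fun i => Z i ω) (fun i => ε i ω) (fun i => η i ω) n)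
          (fun i => Z i ω) -
        b * crossSum n (weakD π₀ c (fun i => Z i ω) (fun i => η i ω) n) (fun i => Z i ω)) /
        √(n : ℝ))
      atTop (id : ℝ → ℝ) (fun _ => P) (gaussianReal (c * (β₁ - b))
        (variance (fun ω => (β₁ - b) * η 0 ω + ε 0 ω) P).toNNReal) := by
    simp only [crossSum_weakY_sub_div_sqrt]
    have h := hclt (β₁ - b) 1
    simp only [one_mul (ε 0 _)] at h
    exact tendstoInDistribution_add_mul_gaussianReal _ h hcov hcovm
  have hDs := tendstoInMeasure_mul_of_tendstoInDistribution hD tendstoInMeasure_inv_sqrt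
    fun _ => aemeasurable_const
  refine ⟨?_, fun hη b hb => ?_⟩
  -- Inversion need only be continuous at the limit `0 + lam₀ > 0`; the denominator itself may
  -- vanish with positive probability.
  · have hden := (hDs.prodMk (tendstoInMeasure_of_tendsto hlam)).comp_continuousAt
      (g := fun p : ℝ × ℝ => (p.1 + p.2)⁻¹)
      (ContinuousAt.inv₀ (by fun_prop) (by simpa using hlam₀.ne'))
    have h := (hA 0).continuous_comp_prodMk_of_tendstoInMeasure_const
      (g := fun p : ℝ × ℝ => p.1 * p.2) (by fun_prop) hden
      fun n => (((hD.forall_aemeasurable n).mul_const _).add_const _).inv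
    refine (tendstoInDistribution_id_of_map_eq h ?_).congr (fun n => .of_forall fun ω => ?_) .rfl
    · simp only [id, zero_add, sub_zero]
      rw [gaussianReal_map_mul_const]
      congr 1
      · rw [div_eq_inv_mul]
      · ext
        rw [NNReal.coe_mul, Real.coe_toNNReal _ (variance_nonneg _ _),
          Real.coe_toNNReal _ (div_nonneg (variance_nonneg _ _) (sq_nonneg _))]
        simp [div_eq_inv_mul]
    · simp only [scaledRidge, ridgeIV, zero_mul, sub_zero]
      rw [div_mul_div_comm, mul_one, Real.mul_self_sqrt (Nat.cast_nonneg n), ← add_div, inv_div, div_mul_div_comm]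
      rw [mul_comm _ (n : ℝ), mul_div_mul_comm, Real.div_sqrt]
  · have hatom {m v : ℝ} (hv : 0 < v) : (gaussianReal m v.toNNReal).map id {0} = 0 := by
      have := nullSingletonClass_gaussianReal (μ := m) (v := v.toNNReal) (by simpa using hv)
      rw [Measure.map_id]
      exact measure_singleton 0
    have hesc (M : ℝ) : Tendsto
        (fun n => P {ω | |RidgeIV.scaledTwoSLS β₀ β₁ π₀ c b Z ε η n ω| ≤ M}) atTop (𝓝 0) := by
      have hM : TendstoInMeasure P (fun (n : ℕ) _ => M * (1 / √(n : ℝ))) atTop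
          fun _ => (0 : ℝ) := by
        simpa using (tendstoInMeasure_inv_sqrt (P := P)).comp_continuousAt
          (g := fun x => M * x) (by fun_prop)
      have h1 := tendsto_measure_abs_le_abs_of_tendstoInDistribution (hA b) (hatom hb)
        (tendstoInMeasure_mul_of_tendstoInDistribution hD hM fun _ => aemeasurable_const)
        fun n => (hD.forall_aemeasurable n).mul_const _
      -- Comparison with the zero sequence bounds the probability of a zero denominator, where
      -- division returns `0` and the ratio argument fails.
      have h2 := tendsto_measure_abs_le_abs_of_tendstoInDistribution hD (hatom hη)
        (tendstoInMeasure_of_tendsto (r := fun _ => 0) tendsto_const_nhds)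
        fun _ => aemeasurable_const
      have h3 := h1.add h2
      rw [add_zero] at h3
      refine tendsto_of_tendsto_of_tendsto_of_le_of_le' tendsto_const_nhds h3
        (.of_forall fun _ => zero_le) ?_
      filter_upwards [eventually_gt_atTop 0] with n hn
      refine (measure_mono fun ω hω => ?_).trans (measure_union_le _ _)
      have hs : 0 < √(n : ℝ) := Real.sqrt_pos.2 (by positivity)
      simp only [Set.mem_union, Set.mem_ofPred_eq, scaledTwoSLS, twoSLS] at hω ⊢
      set y := crossSum n (weakY β₀ β₁ π₀ c (fun i => Z i ω) (fun i => ε i ω)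
        (fun i => η i ω) n) fun i => Z i ω
      set d := crossSum n (weakD π₀ c (fun i => Z i ω) (fun i => η i ω) n) fun i => Z i ω
      rcases eq_or_ne d 0 with hd | hd
      · right; simp [hd]
      · left
        have hd' : 0 < |d| := abs_pos.2 hd
        have e : y - b * d = (y / d - b) * d := by field_simp
        rw [e]
        rw [abs_mul, abs_of_pos hs] at hω
        simp only [abs_div, abs_mul, abs_of_pos hs, abs_one]
        have h4 : |y / d - b| ≤ |M| * (1 / √(n : ℝ)) := by
          rw [mul_one_div, le_div_iff₀ hs, mul_comm]
          exact hω.trans (le_abs_self M)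
        calc |y / d - b| * |d| / √(n : ℝ) ≤ |M| * (1 / √(n : ℝ)) * |d| / √(n : ℝ) := by gcongr
          _ = _ := by ring
    exact ⟨hesc, fun ν _ => not_tendstoInDistribution_of_escape hesc⟩
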